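/- A rational function $F$ over $\mathbb{C}$ is of \emph{type} $(m,k)$ if $F=P/Q$ with coprime polynomials $P,Q\in\mathbb{C}[z]$ with $\deg P=m$ and $\deg Q=k$. Regard $F$ as a holomorphic map from $\mathbb{C}$ to the Riemann sphere $\mathbb{C}_\infty=\mathbb{C}\cup\{\infty\}$. A point $z\in\mathbb{C}$ is a \emph{critical point} of $F$ if $F'(z)=0$ in case $z$ is not a pole of $F$, and if $(1/F)'(z)=0$ in case $z$ is a pole of $F$ (that is, if $z$ is a multiple pole). Let $n\ge 0$ be an integer and let $\eta_1,\dots,\eta_{2n}\in\mathbb{C}$ be distinct. Then there exists a rational function $F$ with the following properties: 1. $F$ is of type $(n+1,n)$; 2. $F$ is normalized: $F=P/Q$ with coprime polynomials $P,Q$ such that the coefficient of $z^n$ in $P$ is zero, i.e. $P(z)=p_{n+1}z^{n+1}+p_{n-1}z^{n-1}+\dots+p_0$, and $F(z)/z\to 1$ as $z\to\infty$; 3. the set of critical points of $F$ in $\mathbb{C}$ is exactly $\{\eta_1,\dots,\eta_{2n}\}$. Moreover, there are only finitely many rational functions $F$ with the properties 1, 2 and 3. -/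

import Mathlib

open Polynomial Filter Topology

/-- `F = P / Q` with coprime polynomials `P` and `Q`, where `Q` is not zero. -/
def IsReducedForm (F : RatFunc ℂ) (P Q : ℂ[X]) : Prop :=
  IsCoprime P Q ∧ Q ≠ 0 ∧ F = algebraMap ℂ[X] (RatFunc ℂ) P / algebraMap ℂ[X] (RatFunc ℂ) Q

/-- `F` is of type `(n, m)`: it is `P / Q` with coprime `P`, `Q` of exact degrees `n`, `m`. -/
def IsOfType (F : RatFunc ℂ) (n m : ℕ) : Prop :=
  ∃ P Q : ℂ[X], IsReducedForm F P Q ∧ P.degree = n ∧ Q.degree = m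

/-- The value of a rational function at a complex number that is not one of its poles. -/
noncomputable def ratVal (F : RatFunc ℂ) (z : ℂ) : ℂ :=
  F.eval (RingHom.id ℂ) z

/-- `z` is a pole of `F`: the denominator of `F` in lowest terms vanishes at `z`. -/
def IsPoleOf (F : RatFunc ℂ) (z : ℂ) : Prop :=
  F.denom.eval z = 0

/-- The critical points in `ℂ` of `F`, as a holomorphic map from `ℂ` to the Riemann sphere.
Away from the poles they are the zeros of `F'`; at a pole the local coordinate of the sphere is
`1 / F`, which is holomorphic there, and the condition reads `(1 / F)' = 0`. -/
def criticalPoints (F : RatFunc ℂ) : Set ℂ :=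
  {z | (¬ IsPoleOf F z ∧ deriv (ratVal F) z = 0) ∨ (IsPoleOf F z ∧ deriv (ratVal F⁻¹) z = 0)}

/-- The normalization of a rational function `F` of type `(n + 1, n)`: the numerator of `F` in
lowest terms has no term of degree `n` (this does not depend on how it is scaled), and
`F z / z → 1` as `z → ∞`. -/
def IsNormalized (n : ℕ) (F : RatFunc ℂ) : Prop :=
  (∃ P Q : ℂ[X], IsReducedForm F P Q ∧ P.coeff n = 0) ∧
    Tendsto (fun z : ℂ => ratVal F z / z) (Bornology.cobounded ℂ) (𝓝 1)

/-! For `F = P / Q` in lowest terms, the critical points, poles included, are the zeros of the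
Wronskian `W = Q P' - Q' P`. The normalization makes `P` and `Q` monic after a common scaling, so
the pair has `2n` free coefficients. Then `W` is monic of degree `2n`, and the problem becomes `W =
∏ (X - η i)`: a polynomial map from affine `2n`-space to itself, to be shown surjective with finite
fibres.

With suitable weights the map is weighted homogeneous, so by
`surjective_and_finite_fiber_of_weightedHomogeneous` it suffices that only the origin maps to zero.
The Nullstellensatz and induction on degree then make the polynomial ring finite over the subalgebra
generated by the components. Integrality gives finite fibres; a transcendence degree count and lying
over give surjectivity.

The fibre over zero is the equation `W = X ^ (2n)`, solved in `eq_X_pow_of_wronskian_eq_X_pow` by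
comparing vanishing orders at zero.

Conversely, a common root of `P` and `Q` would be a double root of `W`, so distinct `η i` force
coprimality (`isCoprime_of_squarefree_wronskian`). -/

namespace MvPolynomial

/-! ### Weighted homogeneous polynomial maps that vanish only at the origin -/

variable {k σ τ : Type*}

/-- Take the component of degree `N` in any representation of `p`: multiplication by `f j` shifts
degrees by `d j`. The alternative `g j = 0` covers `N < d j`, where `N - d j` truncates. -/
theorem IsWeightedHomogeneous.exists_eq_sum_of_mem_span [CommRing k] [Fintype τ] {w : σ → ℕ}
    {f : τ → MvPolynomial σ k} {d : τ → ℕ} (hf : ∀ j, IsWeightedHomogeneous w (f j) (d j))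
    {p : MvPolynomial σ k} {N : ℕ} (hp : IsWeightedHomogeneous w p N)
    (hmem : p ∈ Ideal.span (Set.range f)) :
    ∃ g : τ → MvPolynomial σ k, p = ∑ j, f j * g j ∧
      ∀ j, g j = 0 ∨ d j ≤ N ∧ IsWeightedHomogeneous w (g j) (N - d j) := by
  classical
  let := weightedGradedAlgebra k w
  obtain ⟨c, hc⟩ := Ideal.mem_span_range_iff_exists_fun.1 hmem
  have key : ∀ (j : τ) (q : MvPolynomial σ k),
      ((DirectSum.decompose (weightedHomogeneousSubmodule k w) (f j * q) N :
        weightedHomogeneousSubmodule k w N) : MvPolynomial σ k)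
      = f j * (if d j ≤ N then ((DirectSum.decompose (weightedHomogeneousSubmodule k w) q (N - d j) :
        weightedHomogeneousSubmodule k w (N - d j)) : MvPolynomial σ k) else 0) := by
    intro j q
    rw [DirectSum.coe_decompose_mul_of_left_mem (weightedHomogeneousSubmodule k w) N
      (show f j ∈ weightedHomogeneousSubmodule k w (d j) from hf j)]
    split_ifs <;> simp
  refine ⟨fun j => if d j ≤ N then ((DirectSum.decompose (weightedHomogeneousSubmodule k w) (c j)
        (N - d j) : weightedHomogeneousSubmodule k w (N - d j)) : MvPolynomial σ k) else 0,
    ?_, fun j => ?_⟩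
  · conv_lhs => rw [← DirectSum.decompose_of_mem_same (weightedHomogeneousSubmodule k w) hp, ← hc]
    rw [DirectSum.decompose_sum, DFinsupp.finsetSum_apply, AddSubmonoidClass.coe_finsetSum]
    refine Finset.sum_congr rfl fun j _ => ?_
    rw [mul_comm, key]
  · by_cases h : d j ≤ N
    · right
      simp only [if_pos h]
      exact ⟨h, (DirectSum.decompose (weightedHomogeneousSubmodule k w) (c j) (N - d j)).2⟩
    · left
      simp [h]

/-- If powers of all variables lie in the ideal generated by weighted homogeneous polynomials of
positive degrees, then the polynomial ring is a finite module over the subalgebra they generate. -/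
theorem finite_adjoin_of_X_pow_mem_span [CommRing k] [Fintype σ] [Fintype τ] {w : σ → ℕ}
    {f : τ → MvPolynomial σ k} {d : τ → ℕ} (hd : ∀ j, 0 < d j)
    (hf : ∀ j, IsWeightedHomogeneous w (f j) (d j)) {K : ℕ}
    (hK : ∀ i, (X i : MvPolynomial σ k) ^ K ∈ Ideal.span (Set.range f)) :
    Module.Finite (Algebra.adjoin k (Set.range f)) (MvPolynomial σ k) := by
  classical
  set A := Algebra.adjoin k (Set.range f) with hA
  -- The module generators are the monomials with all exponents below `K`. Any other monomial lies
  -- in the ideal, hence is a combination of the `f j` with coefficients of smaller degree, as `0 <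
  -- d j`; induction on the degree applies to these.
  let B : Set (MvPolynomial σ k) :=
    Set.range fun α : σ → Fin K => monomial (Finsupp.equivFunOnFinite.symm fun i => (α i : ℕ)) 1
  have hB : B.Finite := Set.finite_range _
  have hsmul : ∀ (c : k) (p : MvPolynomial σ k), p ∈ Submodule.span A B →
      c • p ∈ Submodule.span A B := fun c p hp => by
    rw [← algebraMap_smul A c p]; exact Submodule.smul_mem _ _ hp
  have key : ∀ N : ℕ, ∀ p : MvPolynomial σ k, IsWeightedHomogeneous w p N →
      p ∈ Submodule.span A B := by
    intro N
    induction N using Nat.strong_induction_on with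
    | _ N ih =>
    have hI : ∀ p : MvPolynomial σ k, IsWeightedHomogeneous w p N →
        p ∈ Ideal.span (Set.range f) → p ∈ Submodule.span A B := by
      intro p hp hmem
      obtain ⟨g, rfl, hg⟩ := IsWeightedHomogeneous.exists_eq_sum_of_mem_span hf hp hmem
      refine Submodule.sum_mem _ fun j _ => ?_
      have hfj : f j ∈ A := Algebra.subset_adjoin ⟨j, rfl⟩
      have : f j * g j = (⟨f j, hfj⟩ : A) • g j := rfl
      rw [this]
      refine Submodule.smul_mem _ _ ?_
      rcases hg j with h | ⟨hle, h⟩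
      · rw [h]; exact Submodule.zero_mem _
      · exact ih _ (by have := hd j; omega) _ h
    intro p hp
    rw [p.as_sum]
    refine Submodule.sum_mem _ fun α hα => ?_
    have hwα : Finsupp.weight w α = N := hp (mem_support_iff.1 hα)
    have : monomial α (coeff α p) = coeff α p • monomial α (1 : k) := by
      rw [smul_monomial, smul_eq_mul, mul_one]
    rw [this]
    refine hsmul _ _ ?_
    by_cases h : ∀ i, α i < K
    · refine Submodule.subset_span ⟨fun i => ⟨α i, h i⟩, ?_⟩
      ext i
      simp
    · push Not at h
      obtain ⟨i, hi⟩ := h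
      refine hI _ (isWeightedHomogeneous_monomial w α 1 hwα) ?_
      have hle : Finsupp.single i K ≤ α := by simpa using hi
      rw [← tsub_add_cancel_of_le hle, ← mul_one (1 : k), ← monomial_mul, ← X_pow_eq_monomial]
      exact Ideal.mul_mem_left _ _ (hK i)
  refine ⟨⟨hB.toFinset, ?_⟩⟩
  rw [Set.Finite.coe_toFinset, eq_top_iff]
  intro p _
  rw [p.as_sum]
  exact Submodule.sum_mem _ fun α _ => key _ _ (isWeightedHomogeneous_monomial w α _ rfl)

/-- Each variable vanishes on the zero locus, so the Nullstellensatz puts a power of it in `I`;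
finiteness of `σ` gives a common exponent. -/
theorem exists_forall_X_pow_mem_of_zeroLocus [Field k] [IsAlgClosed k] [Finite σ]
    {I : Ideal (MvPolynomial σ k)} (h : ∀ v ∈ zeroLocus k I, v = 0) :
    ∃ K : ℕ, ∀ i, (X i : MvPolynomial σ k) ^ K ∈ I := by
  have : ∀ i, ∃ K : ℕ, (X i : MvPolynomial σ k) ^ K ∈ I := fun i => by
    have : (X i : MvPolynomial σ k) ∈ vanishingIdeal k (zeroLocus k I) := fun v hv => by
      simp [h v hv]
    rwa [vanishingIdeal_zeroLocus_eq_radical] at this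
  choose K hK using this
  obtain ⟨M, hM⟩ := (Set.finite_range K).bddAbove
  exact ⟨M, fun i => Ideal.pow_mem_of_pow_mem I (hK i) (hM ⟨i, rfl⟩)⟩

/-- Every element of the subalgebra is constant on the fibre. A monic equation for `X i` thus
specializes to one monic polynomial over `k` having the `i`-th coordinates of all points of the
fibre among its roots. -/
theorem finite_fiber_of_isIntegral_adjoin [Field k] [Finite σ] {f : τ → MvPolynomial σ k}
    (hf : Algebra.IsIntegral (Algebra.adjoin k (Set.range f)) (MvPolynomial σ k)) (c : τ → k) :
    {v : σ → k | ∀ j, eval v (f j) = c j}.Finite := by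
  have hc : ∀ a ∈ Algebra.adjoin k (Set.range f), ∃ e : k, ∀ v : σ → k,
      (∀ j, eval v (f j) = c j) → eval v a = e := by
    intro a ha
    induction ha using Algebra.adjoin_induction with
    | mem x hx => obtain ⟨j, rfl⟩ := hx; exact ⟨c j, fun v hv => hv j⟩
    | algebraMap r => exact ⟨r, fun v _ => by simp [algebraMap_eq]⟩
    | add x y _ _ hx hy =>
      obtain ⟨a, ha⟩ := hx; obtain ⟨b, hb⟩ := hy
      exact ⟨a + b, fun v hv => by rw [map_add, ha v hv, hb v hv]⟩
    | mul x y _ _ hx hy =>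
      obtain ⟨a, ha⟩ := hx; obtain ⟨b, hb⟩ := hy
      exact ⟨a * b, fun v hv => by rw [map_mul, ha v hv, hb v hv]⟩
  rcases Set.eq_empty_or_nonempty {v : σ → k | ∀ j, eval v (f j) = c j} with h0 | ⟨v₀, hv₀⟩
  · rw [h0]; exact Set.finite_empty
  let φ : Algebra.adjoin k (Set.range f) →+* k :=
    (eval v₀).comp (Algebra.adjoin k (Set.range f)).subtype
  have hφ : ∀ v : σ → k, (∀ j, eval v (f j) = c j) →
      (eval v).comp (algebraMap (Algebra.adjoin k (Set.range f)) (MvPolynomial σ k)) = φ := by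
    intro v hv
    ext ⟨a, ha⟩
    obtain ⟨e, he⟩ := hc a ha
    exact (he v hv).trans (he v₀ hv₀).symm
  have hr : ∀ i : σ, ∃ s : Set k, s.Finite ∧ ∀ v : σ → k, (∀ j, eval v (f j) = c j) → v i ∈ s := by
    intro i
    obtain ⟨q, hq, hq0⟩ := hf.isIntegral (X i : MvPolynomial σ k)
    refine ⟨{x | (q.map φ).IsRoot x}, Polynomial.finite_setOfPred_isRoot (hq.map φ).ne_zero, ?_⟩
    intro v hv
    have := congrArg (eval v) hq0
    rw [Polynomial.hom_eval₂, hφ v hv, eval_X, map_zero] at this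
    rwa [Set.mem_ofPred_eq, Polynomial.IsRoot.def, Polynomial.eval_map]
  choose s hs hvs using hr
  exact (Set.Finite.pi' hs).subset fun v hv i => hvs i v hv

/-- The polynomial ring is algebraic over the subalgebra, and the number of generators equals the
transcendence degree, which leaves no room for a relation. -/
theorem algebraicIndependent_of_isIntegral_adjoin [Field k] [Fintype σ] [Fintype τ]
    (hcard : Fintype.card τ = Fintype.card σ) {f : τ → MvPolynomial σ k}
    (hf : Algebra.IsIntegral (Algebra.adjoin k (Set.range f)) (MvPolynomial σ k)) :
    AlgebraicIndependent k f := by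
  have : Algebra.IsAlgebraic (Algebra.adjoin k (Set.range f)) (MvPolynomial σ k) := inferInstance
  refine (Algebra.IsAlgebraic.isTranscendenceBasis_of_lift_le_trdeg_of_finite k f ?_).1
  rw [MvPolynomial.trdeg_of_isDomain]
  simp [hcard]

/-- By independence `aeval f` is an injective integral extension. Lying over lifts the maximal ideal
of the point `c`, and by the Nullstellensatz the lift is the ideal of a point `v`. -/
theorem exists_eval_eq_of_isIntegral_adjoin [Field k] [IsAlgClosed k] [Finite σ] [Finite τ]
    {f : τ → MvPolynomial σ k} (hind : AlgebraicIndependent k f)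
    (hf : Algebra.IsIntegral (Algebra.adjoin k (Set.range f)) (MvPolynomial σ k)) (c : τ → k) :
    ∃ v : σ → k, ∀ j, eval v (f j) = c j := by
  let g : MvPolynomial τ k →ₐ[k] MvPolynomial σ k := aeval f
  have hg : g.toRingHom.IsIntegral := by
    have h1 : (algebraMap (Algebra.adjoin k (Set.range f)) (MvPolynomial σ k)).IsIntegral :=
      hf.isIntegral
    have h2 : (hind.aevalEquiv : MvPolynomial τ k →+* Algebra.adjoin k (Set.range f)).IsIntegral :=
      RingHom.isIntegral_of_surjective _ hind.aevalEquiv.surjective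
    have heq : g.toRingHom = (algebraMap (Algebra.adjoin k (Set.range f)) (MvPolynomial σ k)).comp
        (hind.aevalEquiv : MvPolynomial τ k →+* Algebra.adjoin k (Set.range f)) :=
      RingHom.ext fun x => (hind.algebraMap_aevalEquiv x).symm
    rw [heq]
    exact RingHom.IsIntegral.trans _ _ h2 h1
  let := g.toRingHom.toAlgebra
  have : Algebra.IsIntegral (MvPolynomial τ k) (MvPolynomial σ k) := ⟨hg⟩
  have hinj : Function.Injective (algebraMap (MvPolynomial τ k) (MvPolynomial σ k)) := hind
  obtain ⟨Q, hQ, hQc⟩ := Ideal.exists_ideal_over_maximal_of_isIntegral (S := MvPolynomial σ k)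
    (vanishingIdeal k {c}) (by rw [(RingHom.injective_iff_ker_eq_bot _).1 hinj]; exact bot_le)
  obtain ⟨v, rfl⟩ := eq_vanishingIdeal_singleton_of_isMaximal k hQ
  refine ⟨v, fun j => ?_⟩
  have h1 : X j - C (c j) ∈ vanishingIdeal k {c} := by
    rw [mem_vanishingIdeal_singleton_iff]; simp
  rw [← hQc, Ideal.mem_comap, mem_vanishingIdeal_singleton_iff] at h1
  have h2 : algebraMap (MvPolynomial τ k) (MvPolynomial σ k) (X j - C (c j)) = f j - C (c j) := by
    change g _ = _
    simp [g, algebraMap_eq]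
  rw [h2] at h1
  simpa [sub_eq_zero, aeval_eq_eval] using h1

/-- A weighted homogeneous polynomial self-map of affine space whose only zero is the origin is
surjective with finite fibres. -/
theorem surjective_and_finite_fiber_of_weightedHomogeneous [Field k] [IsAlgClosed k]
    [Fintype σ] [Fintype τ] (hcard : Fintype.card τ = Fintype.card σ) {w : σ → ℕ}
    {f : τ → MvPolynomial σ k} {d : τ → ℕ} (hd : ∀ j, 0 < d j)
    (hf : ∀ j, IsWeightedHomogeneous w (f j) (d j))
    (h0 : ∀ v : σ → k, (∀ j, eval v (f j) = 0) → v = 0) (c : τ → k) :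
    (∃ v : σ → k, ∀ j, eval v (f j) = c j) ∧ {v : σ → k | ∀ j, eval v (f j) = c j}.Finite := by
  obtain ⟨K, hK⟩ := exists_forall_X_pow_mem_of_zeroLocus (I := Ideal.span (Set.range f))
    fun v hv => h0 v fun j => by simpa [aeval_eq_eval] using hv _ (Ideal.subset_span ⟨j, rfl⟩)
  have := finite_adjoin_of_X_pow_mem_span hd hf hK
  have hint : Algebra.IsIntegral (Algebra.adjoin k (Set.range f)) (MvPolynomial σ k) :=
    inferInstance
  exact ⟨exists_eval_eq_of_isIntegral_adjoin
    (algebraicIndependent_of_isIntegral_adjoin hcard hint) hint c,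
    finite_fiber_of_isIntegral_adjoin hint c⟩

end MvPolynomial

/-! ### Normalized monic polynomials and their Wronskians -/

namespace Polynomial

/-- The monic polynomial of degree `m` whose coefficients of degree `< n` are given by `a` and
whose coefficients of degrees in `[n, m)` vanish. -/
noncomputable def gapMonic {R : Type*} [CommRing R] (m : ℕ) {n : ℕ} (a : Fin n → R) : R[X] :=
  X ^ m + ∑ i : Fin n, C (a i) * X ^ (i : ℕ)

section gapMonic

variable {R S : Type*} [CommRing R] [CommRing S] {m n : ℕ}

theorem coeff_sum_fin (a : Fin n → R) (j : ℕ) :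
    (∑ i : Fin n, C (a i) * X ^ (i : ℕ)).coeff j = if h : j < n then a ⟨j, h⟩ else 0 := by
  rw [finsetSum_coeff]
  simp only [coeff_C_mul_X_pow]
  split_ifs with h
  · rw [Finset.sum_eq_single ⟨j, h⟩] <;> simp
    intro b hb hj
    exact absurd (Fin.ext hj.symm) hb
  · refine Finset.sum_eq_zero fun i _ => if_neg ?_
    have := i.2
    omega

theorem coeff_gapMonic (a : Fin n → R) (j : ℕ) :
    (gapMonic m a).coeff j = (if j = m then 1 else 0) + if h : j < n then a ⟨j, h⟩ else 0 := by
  rw [gapMonic, coeff_add, coeff_X_pow, coeff_sum_fin]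

theorem degree_sum_fin_lt_of_le (hnm : n ≤ m) (a : Fin n → R) :
    (∑ i : Fin n, C (a i) * X ^ (i : ℕ)).degree < (m : WithBot ℕ) :=
  (degree_sum_fin_lt a).trans_le (Nat.cast_le.2 hnm)

theorem monic_gapMonic (hnm : n ≤ m) (a : Fin n → R) : (gapMonic m a).Monic :=
  monic_X_pow_add (degree_sum_fin_lt_of_le hnm a)

theorem degree_gapMonic [Nontrivial R] (hnm : n ≤ m) (a : Fin n → R) :
    (gapMonic m a).degree = m := by
  rw [gapMonic, add_comm, degree_add_eq_right_of_degree_lt, degree_X_pow]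
  rw [degree_X_pow]
  exact degree_sum_fin_lt_of_le hnm a

theorem natDegree_gapMonic [Nontrivial R] (hnm : n ≤ m) (a : Fin n → R) :
    (gapMonic m a).natDegree = m :=
  natDegree_eq_of_degree_eq_some (degree_gapMonic hnm a)

theorem map_gapMonic (φ : R →+* S) (a : Fin n → R) :
    (gapMonic m a).map φ = gapMonic m (φ ∘ a) := by
  simp [gapMonic, Polynomial.map_sum]

theorem eq_gapMonic {p : R[X]} (hp : p.Monic) (hdeg : p.natDegree = m) (hnm : n ≤ m)
    (hgap : ∀ j, n ≤ j → j < m → p.coeff j = 0) :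
    p = gapMonic m fun i : Fin n => p.coeff i := by
  ext j
  rw [coeff_gapMonic]
  rcases lt_trichotomy j m with h | rfl | h
  · rw [if_neg h.ne, zero_add]
    split_ifs with h'
    · rfl
    · exact hgap j (not_lt.1 h') h
  · rw [if_pos rfl, dif_neg (not_lt.2 hnm), add_zero, ← hdeg]
    exact hp
  · rw [if_neg h.ne', dif_neg (by omega), add_zero]
    exact coeff_eq_zero_of_natDegree_lt (hdeg ▸ h)

end gapMonic

section Wronskian

variable {R S : Type*} [CommRing R] [CommRing S]

theorem map_wronskian (φ : R →+* S) (p q : R[X]) :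
    (wronskian p q).map φ = wronskian (p.map φ) (q.map φ) := by
  simp [wronskian, derivative_map]

/-- The factor `X` turns differentiation into the Euler operator, which multiplies the `j`-th
coefficient by `j` and keeps degrees; this avoids the truncated exponent `a + b - 1`. -/
theorem X_mul_wronskian_coeff {p q : R[X]} {a b : ℕ} (hp : p.natDegree ≤ a)
    (hq : q.natDegree ≤ b) :
    (X * wronskian p q).coeff (a + b) = ((b : R) - a) * (p.coeff a * q.coeff b) := by
  have hX : ∀ (r : R[X]) (j : ℕ), (X * derivative r).coeff j = j * r.coeff j := by
    intro r j
    cases j with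
    | zero => simp
    | succ j => rw [coeff_X_mul, coeff_derivative]; push_cast; ring
  have hd : ∀ {r : R[X]} {c : ℕ}, r.natDegree ≤ c → (X * derivative r).natDegree ≤ c := by
    intro r c hr
    rw [natDegree_le_iff_coeff_eq_zero] at hr ⊢
    intro j hj
    rw [hX, hr j hj, mul_zero]
  have : X * wronskian p q = p * (X * derivative q) - (X * derivative p) * q := by
    rw [wronskian]; ring
  rw [this, coeff_sub, coeff_mul_add_eq_of_natDegree_le hp (hd hq), coeff_mul_add_eq_of_natDegree_le (hd hp) hq,
    hX, hX]
  ring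

theorem natDegree_X_mul_wronskian_le {p q : R[X]} {a b : ℕ} (hp : p.natDegree ≤ a)
    (hq : q.natDegree ≤ b) : (X * wronskian p q).natDegree ≤ a + b := by
  by_cases hw : wronskian p q = 0
  · simp [hw]
  · have h1 := natDegree_wronskian_lt_add hw
    have h2 : (X * wronskian p q).natDegree ≤ _ := natDegree_mul_le
    have h3 : (X : R[X]).natDegree ≤ 1 := natDegree_X_le
    omega

theorem monic_wronskian {n : ℕ} {p q : R[X]} (hp : p.Monic) (hpn : p.natDegree = n + 1)
    (hq : q.Monic) (hqn : q.natDegree = n) :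
    (wronskian q p).natDegree ≤ 2 * n ∧ (wronskian q p).coeff (2 * n) = 1 := by
  have h1 := X_mul_wronskian_coeff hqn.le hpn.le
  have h2 := natDegree_X_mul_wronskian_le hqn.le hpn.le
  constructor
  · rw [natDegree_le_iff_coeff_eq_zero] at h2 ⊢
    intro j hj
    rw [← coeff_X_mul]
    exact h2 _ (by omega)
  · have hp1 : p.coeff (n + 1) = 1 := hpn ▸ hp
    have hq1 : q.coeff n = 1 := hqn ▸ hq
    rw [show n + (n + 1) = 2 * n + 1 by ring, coeff_X_mul, hp1, hq1] at h1
    rw [h1]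
    push_cast
    ring

/-- The Wronskian of polynomials with vanishing orders `a` and `b` at zero. -/
theorem X_mul_wronskian_X_pow_mul (a b : ℕ) (u v : R[X]) :
    X * wronskian (X ^ a * u) (X ^ b * v) =
      X ^ (a + b) * (C ((b : R) - a) * (u * v) + X * wronskian u v) := by
  have h : ∀ c : ℕ, X * derivative (X ^ c : R[X]) = C (c : R) * X ^ c := by
    intro c
    cases c with
    | zero => simp
    | succ c => rw [derivative_X_pow]; simp only [Nat.add_sub_cancel]; ring
  have e : X * wronskian (X ^ a * u) (X ^ b * v) =
      X ^ a * u * ((X * derivative (X ^ b : R[X])) * v + X ^ b * (X * derivative v)) -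
      ((X * derivative (X ^ a : R[X])) * u + X ^ a * (X * derivative u)) * (X ^ b * v) := by
    rw [wronskian, derivative_mul, derivative_mul]; ring
  rw [e, h, h, wronskian, C_sub, pow_add]
  ring

end Wronskian

theorem exists_eq_X_pow_mul {k : Type*} [Field k] {p : k[X]} (hp : p ≠ 0) :
    ∃ (a : ℕ) (u : k[X]), p = X ^ a * u ∧ u.coeff 0 ≠ 0 ∧ a ≤ p.natDegree := by
  obtain ⟨u, hu, hnd⟩ := exists_eq_pow_rootMultiplicity_mul_and_not_dvd p hp 0
  rw [C_0, sub_zero] at hu hnd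
  refine ⟨_, u, hu, fun h => hnd (X_dvd_iff.2 h), ?_⟩
  have hu0 : u ≠ 0 := fun h => hnd (h ▸ dvd_zero _)
  conv_rhs => rw [hu]
  rw [natDegree_X_pow_mul _ hu0]
  omega

/-- If the Wronskian of `q` and `p` is `X ^ (2 * n)`, with `q`, `p` monic of degrees `n`, `n + 1`,
and the vanishing orders of `q` and `p` at zero differ, then `q = X ^ n` and `p = X ^ (n + 1)`. -/
theorem eq_X_pow_of_wronskian_eq_X_pow_aux {k : Type*} [Field k] [CharZero k] {n : ℕ}
    {p q u v : k[X]} (hp : p.Monic) (hpn : p.natDegree = n + 1) (hq : q.Monic)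
    (hqn : q.natDegree = n) (hw : wronskian q p = X ^ (2 * n)) {a b : ℕ}
    (hqu : q = X ^ a * u) (hu : u.coeff 0 ≠ 0) (ha : a ≤ n)
    (hpv : p = X ^ b * v) (hv : v.coeff 0 ≠ 0) (hb : b ≤ n + 1) (hab : a ≠ b) :
    p = X ^ (n + 1) ∧ q = X ^ n := by
  have hX := X_mul_wronskian_X_pow_mul a b u v
  rw [← hqu, ← hpv, hw] at hX
  have hc := congrArg (fun r => coeff r (a + b)) hX
  simp only [← pow_succ'] at hc
  have e : (X ^ (a + b) * (C ((b : k) - a) * (u * v) + X * wronskian u v)).coeff (a + b) =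
      ((b : k) - a) * (u.coeff 0 * v.coeff 0) := by
    have := coeff_X_pow_mul (C ((b : k) - a) * (u * v) + X * wronskian u v) (a + b) 0
    rw [zero_add] at this
    rw [this]
    simp [mul_coeff_zero]
  rw [e, coeff_X_pow] at hc
  have hne : ((b : k) - a) * (u.coeff 0 * v.coeff 0) ≠ 0 :=
    mul_ne_zero (sub_ne_zero.2 fun h => hab (by exact_mod_cast h.symm)) (mul_ne_zero hu hv)
  -- The coefficient of `X ^ (a + b)` is nonzero on the right, while the left side is `X ^ (2n +
  -- 1)`. With `a ≤ n` and `b ≤ n + 1`, both bounds are then attained.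
  have hab2 : a + b = 2 * n + 1 := by
    by_contra h
    rw [if_neg h] at hc
    exact hne hc.symm
  obtain rfl : a = n := by omega
  obtain rfl : b = a + 1 := by omega
  have aux : ∀ {r s : k[X]} {c : ℕ}, r.Monic → r.natDegree = c → r = X ^ c * s → r = X ^ c := by
    intro r s c hr hrc hrs
    have hs : s.Monic := (monic_X_pow c).of_mul_monic_left (hrs ▸ hr)
    have : s.natDegree = 0 := by
      have := congrArg natDegree hrs
      rw [natDegree_X_pow_mul _ hs.ne_zero, hrc] at this
      omega
    rw [hrs, hs.natDegree_eq_zero.1 this, mul_one]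
  exact ⟨aux hp hpn hpv, aux hq hqn hqu⟩

/-- Replacing `p` by `p - c q` leaves the Wronskian unchanged, so equal vanishing orders at zero can
be made different. -/
theorem eq_X_pow_of_wronskian_eq_X_pow {k : Type*} [Field k] [CharZero k] {n : ℕ}
    {p q : k[X]} (hp : p.Monic) (hpn : p.natDegree = n + 1) (hp0 : p.coeff n = 0) (hq : q.Monic)
    (hqn : q.natDegree = n) (hw : wronskian q p = X ^ (2 * n)) :
    p = X ^ (n + 1) ∧ q = X ^ n := by
  obtain ⟨a, u, hqu, hu, ha⟩ := exists_eq_X_pow_mul hq.ne_zero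
  obtain ⟨b, v, hpv, hv, hb⟩ := exists_eq_X_pow_mul hp.ne_zero
  rw [hqn] at ha
  rw [hpn] at hb
  rcases ne_or_eq a b with hab | rfl
  · exact eq_X_pow_of_wronskian_eq_X_pow_aux hp hpn hq hqn hw hqu hu ha hpv hv hb hab
  -- subtract the multiple of `q` which raises the vanishing order of `p`
  set c : k := v.coeff 0 / u.coeff 0 with hc
  have hdeg : (-(C c * q)).degree < p.degree := by
    rw [degree_neg, degree_eq_natDegree hp.ne_zero, hpn]
    refine (degree_le_of_natDegree_le (natDegree_C_mul_le c q)).trans_lt ?_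
    rw [hqn]
    exact_mod_cast n.lt_succ_self
  have hp' : (p + -(C c * q)).Monic := hp.add_of_left hdeg
  have hpn' : (p + -(C c * q)).natDegree = n + 1 := by
    rw [natDegree_add_eq_left_of_degree_lt hdeg, hpn]
  have hw' : wronskian q (p + -(C c * q)) = X ^ (2 * n) := by
    rw [← hw, wronskian, wronskian, derivative_add, derivative_neg, derivative_C_mul]
    ring
  obtain ⟨b, v', hpv', hv', hb'⟩ := exists_eq_X_pow_mul hp'.ne_zero
  have hab : a ≠ b := by
    rintro rfl
    have : v' = v - C c * u := by
      refine mul_left_cancel₀ (pow_ne_zero a (X_ne_zero (R := k))) ?_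
      rw [← hpv', mul_sub, ← hpv, hqu]
      ring
    apply hv'
    rw [this, coeff_sub, coeff_C_mul, hc, div_mul_cancel₀ _ hu, sub_self]
  obtain ⟨h1, h2⟩ := eq_X_pow_of_wronskian_eq_X_pow_aux hp' hpn' hq hqn hw' hqu hu ha hpv' hv'
    (hpn' ▸ hb') hab
  -- Now `p - c q = X ^ (n + 1)`. As `p` has no term of degree `n` and `q` is monic of degree `n`,
  -- comparing coefficients of `X ^ n` gives `c = 0`; this is where the normalization enters.
  have h3 := congrArg (fun r => coeff r n) h1
  have h4 : q.coeff n = 1 := hqn ▸ hq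
  simp only [coeff_add, coeff_neg, coeff_C_mul, hp0, h4, coeff_X_pow] at h3
  have hc0 : c = 0 := by simpa using h3
  rw [hc0] at h1
  exact ⟨by simpa using h1, h2⟩

end Polynomial

/-! ### Weighted homogeneity of the coefficients of a Wronskian -/

namespace MvPolynomial

variable {k σ : Type*} [CommRing k]

/-- `G` is weighted homogeneous of degree `d` when the variable `X` is given the weight one. -/
def IsWeightedHomogeneousCoeffs (w : σ → ℤ) (G : (MvPolynomial σ k)[X]) (d : ℤ) : Prop :=
  ∀ j : ℕ, IsWeightedHomogeneous w (G.coeff j) (d - j)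

namespace IsWeightedHomogeneousCoeffs

variable {w : σ → ℤ} {G H : (MvPolynomial σ k)[X]} {d e : ℤ}

theorem sub (hG : IsWeightedHomogeneousCoeffs w G d) (hH : IsWeightedHomogeneousCoeffs w H d) :
    IsWeightedHomogeneousCoeffs w (G - H) d := fun j => by
  rw [Polynomial.coeff_sub]; exact (hG j).sub (hH j)

theorem mul (hG : IsWeightedHomogeneousCoeffs w G d) (hH : IsWeightedHomogeneousCoeffs w H e) :
    IsWeightedHomogeneousCoeffs w (G * H) (d + e) := fun j => by
  rw [Polynomial.coeff_mul]
  refine IsWeightedHomogeneous.sum _ _ _ fun x hx => ?_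
  have := (hG x.1).mul (hH x.2)
  rw [← Finset.HasAntidiagonal.mem_antidiagonal.1 hx]
  convert this using 1
  push_cast
  ring

theorem derivative (hG : IsWeightedHomogeneousCoeffs w G d) :
    IsWeightedHomogeneousCoeffs w (Polynomial.derivative G) (d - 1) := fun j => by
  rw [Polynomial.coeff_derivative]
  have := (hG (j + 1)).mul (isWeightedHomogeneous_C w ((j : k) + 1))
  convert this using 1
  · simp
  · push_cast; ring

theorem wronskian (hG : IsWeightedHomogeneousCoeffs w G d)
    (hH : IsWeightedHomogeneousCoeffs w H e) :
    IsWeightedHomogeneousCoeffs w (Polynomial.wronskian G H) (d + e - 1) := by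
  have h1 := hG.mul hH.derivative
  have h2 := hG.derivative.mul hH
  rw [← add_sub_assoc] at h1
  rw [sub_add_eq_add_sub] at h2
  exact h1.sub h2

theorem gapMonic {m n : ℕ} {a : Fin n → MvPolynomial σ k}
    (ha : ∀ i : Fin n, IsWeightedHomogeneous w (a i) ((m : ℤ) - (i : ℕ))) :
    IsWeightedHomogeneousCoeffs w (Polynomial.gapMonic m a) m := fun j => by
  rw [coeff_gapMonic]
  refine IsWeightedHomogeneous.add ?_ ?_
  · split_ifs with h
    · rw [h, sub_self]; exact isWeightedHomogeneous_one _ _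
    · exact isWeightedHomogeneous_zero _ _ _
  · split_ifs with h
    · exact ha ⟨j, h⟩
    · exact isWeightedHomogeneous_zero _ _ _

end IsWeightedHomogeneousCoeffs

/-- Degrees `d - j` are computed in `ℤ`, where subtraction is genuine; this returns to the natural
weights on which the finiteness argument does its induction. -/
theorem IsWeightedHomogeneous.of_intCast {w : σ → ℕ} {p : MvPolynomial σ k} {d : ℕ}
    (hp : IsWeightedHomogeneous (fun i => (w i : ℤ)) p (d : ℤ)) : IsWeightedHomogeneous w p d := by
  intro α hα
  have := hp hα
  rw [Finsupp.weight_apply, Finsupp.sum] at this ⊢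
  simp only [nsmul_eq_mul, smul_eq_mul] at this ⊢
  exact_mod_cast this

end MvPolynomial

/-! ### The Wronskian map on normalized pairs -/

namespace Polynomial

/-- A polynomial is the Wronskian of a normalized pair of monic polynomials of degrees `n`, `n + 1`
if it is monic of degree `2 * n`, and there are finitely many such pairs. -/
theorem exists_wronskian_gapMonic_and_finite {k : Type*} [Field k] [CharZero k] [IsAlgClosed k]
    {n : ℕ} {T : k[X]} (hT : T.Monic) (hTn : T.natDegree = 2 * n) :
    (∃ v : Fin n ⊕ Fin n → k,
      wronskian (gapMonic n (v ∘ Sum.inr)) (gapMonic (n + 1) (v ∘ Sum.inl)) = T) ∧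
    {v : Fin n ⊕ Fin n → k |
      wronskian (gapMonic n (v ∘ Sum.inr)) (gapMonic (n + 1) (v ∘ Sum.inl)) = T}.Finite := by
  -- The coefficient of `X ^ i` gets weight `n + 1 - i` in `p` and `n - i` in `q`, so that `p` and
  -- `q` are homogeneous of degrees `n + 1` and `n` when `X` has weight one.
  let w : Fin n ⊕ Fin n → ℕ := Sum.elim (fun i => n + 1 - i) (fun i => n - i)
  let W : (MvPolynomial (Fin n ⊕ Fin n) k)[X] :=
    wronskian (gapMonic n (MvPolynomial.X ∘ Sum.inr)) (gapMonic (n + 1) (MvPolynomial.X ∘ Sum.inl))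
  -- The coefficient of `X ^ (2n)` is always 1 and is left out, so there are as many equations as
  -- unknowns, all of positive degree `2n - j`.
  let f : Fin (2 * n) → MvPolynomial (Fin n ⊕ Fin n) k := fun j => W.coeff j
  have hf : ∀ j : Fin (2 * n), MvPolynomial.IsWeightedHomogeneous w (f j) (2 * n - j) := by
    have hW : MvPolynomial.IsWeightedHomogeneousCoeffs (fun i => (w i : ℤ)) W
        ((n : ℕ) + (n + 1 : ℕ) - 1) := by
      refine .wronskian (.gapMonic fun i => ?_) (.gapMonic fun i => ?_)
      · have hX := MvPolynomial.isWeightedHomogeneous_X k (fun i => (w i : ℤ)) (Sum.inr i)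
        have e : ((w (Sum.inr i) : ℕ) : ℤ) = (n : ℕ) - (i : ℕ) :=
          Nat.cast_sub i.2.le
        rwa [e] at hX
      · have hX := MvPolynomial.isWeightedHomogeneous_X k (fun i => (w i : ℤ)) (Sum.inl i)
        have e : ((w (Sum.inl i) : ℕ) : ℤ) = (n + 1 : ℕ) - (i : ℕ) :=
          Nat.cast_sub (i.2.le.trans n.le_succ)
        rwa [e] at hX
    intro j
    apply MvPolynomial.IsWeightedHomogeneous.of_intCast
    convert hW j using 1
    have := j.2
    omega
  have heval : ∀ v : Fin n ⊕ Fin n → k, W.map (MvPolynomial.eval v) =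
      wronskian (gapMonic n (v ∘ Sum.inr)) (gapMonic (n + 1) (v ∘ Sum.inl)) := by
    intro v
    have (s : Fin n → Fin n ⊕ Fin n) :
        MvPolynomial.eval v ∘ MvPolynomial.X ∘ s = v ∘ s := by ext; simp
    simp only [W, map_wronskian, map_gapMonic, this]
  have hiff : ∀ (S : k[X]), S.Monic → S.natDegree = 2 * n → ∀ v : Fin n ⊕ Fin n → k,
      (∀ j, MvPolynomial.eval v (f j) = S.coeff j) ↔
      wronskian (gapMonic n (v ∘ Sum.inr)) (gapMonic (n + 1) (v ∘ Sum.inl)) = S := by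
    intro S hS hSn v
    have hj : ∀ j : Fin (2 * n), MvPolynomial.eval v (f j) =
        (wronskian (gapMonic n (v ∘ Sum.inr)) (gapMonic (n + 1) (v ∘ Sum.inl))).coeff j :=
      fun j => by rw [← heval, coeff_map]
    simp only [hj]
    refine ⟨fun h => ?_, fun h j => by rw [h]⟩
    obtain ⟨h1, h2⟩ := monic_wronskian (monic_gapMonic n.le_succ (v ∘ Sum.inl))
      (natDegree_gapMonic n.le_succ _) (monic_gapMonic le_rfl (v ∘ Sum.inr))
      (natDegree_gapMonic le_rfl _)
    ext j
    rcases lt_trichotomy j (2 * n) with hj | rfl | hj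
    · exact h ⟨j, hj⟩
    · rw [h2, ← hSn]; exact hS.symm
    · rw [coeff_eq_zero_of_natDegree_lt (h1.trans_lt hj),
        coeff_eq_zero_of_natDegree_lt (hSn ▸ hj)]
  have h0 : ∀ v : Fin n ⊕ Fin n → k, (∀ j, MvPolynomial.eval v (f j) = 0) → v = 0 := by
    intro v hv
    -- Vanishing of all lower coefficients means that the Wronskian is `X ^ (2n)`.
    have hw := (hiff (X ^ (2 * n)) (monic_X_pow _) (natDegree_X_pow _) v).1 fun j => by
      rw [hv, coeff_X_pow, if_neg j.2.ne]
    obtain ⟨hp, hq⟩ := eq_X_pow_of_wronskian_eq_X_pow (monic_gapMonic n.le_succ (v ∘ Sum.inl))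
      (natDegree_gapMonic n.le_succ _) (by simp [coeff_gapMonic])
      (monic_gapMonic le_rfl (v ∘ Sum.inr)) (natDegree_gapMonic le_rfl _) hw
    have aux : ∀ (m : ℕ) (a : Fin n → k), gapMonic m a = X ^ m → ∀ i, a i = 0 := by
      intro m a h i
      have := congrArg (fun r => coeff r (i : ℕ)) h
      simpa [coeff_gapMonic, coeff_X_pow] using this
    funext i
    rcases i with i | i
    · exact aux _ _ hp i
    · exact aux _ _ hq i
  have := MvPolynomial.surjective_and_finite_fiber_of_weightedHomogeneous (by simp; ring)
    (fun j => by have := j.2; omega) hf h0 (fun j => T.coeff j)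
  simpa only [hiff T hT hTn] using this

end Polynomial

/-! ### Reduced forms, critical points and behaviour at infinity -/

namespace IsReducedForm

variable {F : RatFunc ℂ} {P Q : ℂ[X]}

theorem exists_eq_C_mul (h : IsReducedForm F P Q) :
    ∃ c : ℂ, c ≠ 0 ∧ P = C c * F.num ∧ Q = C c * F.denom := by
  obtain ⟨hco, hQ, hF⟩ := h
  have hcross := (RatFunc.num_mul_eq_mul_denom_iff hQ).2 hF
  have h1 : Q ∣ F.denom := hco.symm.dvd_of_dvd_mul_left (Dvd.intro_left _ hcross)
  have h2 : F.denom ∣ Q :=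
    F.isCoprime_num_denom.symm.dvd_of_dvd_mul_left (Dvd.intro_left _ hcross.symm)
  obtain ⟨u, hu⟩ := associated_of_dvd_dvd h2 h1
  obtain ⟨c, hc, hcu⟩ := Polynomial.isUnit_iff.1 u.isUnit
  have hQc : Q = C c * F.denom := by rw [hcu, mul_comm, hu]
  refine ⟨c, hc.ne_zero, ?_, hQc⟩
  refine mul_right_cancel₀ F.denom_ne_zero ?_
  rw [← hcross, hQc]
  ring

theorem ratVal_eq (h : IsReducedForm F P Q) (z : ℂ) : ratVal F z = P.eval z / Q.eval z := by
  obtain ⟨c, hc, rfl, rfl⟩ := h.exists_eq_C_mul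
  rw [ratVal, RatFunc.eval, eval₂_id, eval₂_id, eval_mul, eval_mul, eval_C, mul_div_mul_left _ _ hc]

theorem isPoleOf_iff (h : IsReducedForm F P Q) (z : ℂ) : IsPoleOf F z ↔ Q.eval z = 0 := by
  obtain ⟨c, hc, -, rfl⟩ := h.exists_eq_C_mul
  simp [IsPoleOf, hc]

theorem inv (h : IsReducedForm F P Q) (hP : P ≠ 0) : IsReducedForm F⁻¹ Q P :=
  ⟨h.1.symm, hP, by rw [h.2.2, inv_div]⟩

theorem C_mul (h : IsReducedForm F P Q) {c : ℂ} (hc : c ≠ 0) :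
    IsReducedForm F (C c * P) (C c * Q) := by
  obtain ⟨hco, hQ, hF⟩ := h
  have hu : IsUnit (C c) := isUnit_C.2 hc.isUnit
  refine ⟨(isCoprime_mul_unit_left hu P Q).2 hco, mul_ne_zero (C_ne_zero.2 hc) hQ, ?_⟩
  rw [hF, map_mul, map_mul, mul_div_mul_left]
  exact RatFunc.algebraMap_ne_zero (C_ne_zero.2 hc)

theorem deriv_ratVal (h : IsReducedForm F P Q) {z : ℂ} (hz : Q.eval z ≠ 0) :
    deriv (ratVal F) z = (wronskian Q P).eval z / Q.eval z ^ 2 := by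
  have : ratVal F = fun z => P.eval z / Q.eval z := funext h.ratVal_eq
  rw [this]
  refine ((P.hasDerivAt z).div (Q.hasDerivAt z) hz).deriv.trans ?_
  simp only [wronskian, eval_sub, eval_mul]
  ring

/-- At a pole the numerator is nonzero by coprimality. Passing to `F⁻¹` swaps `P` and `Q`, which
only changes the sign of the Wronskian, so both cases give the same condition. -/
theorem mem_criticalPoints_iff (h : IsReducedForm F P Q) (z : ℂ) :
    z ∈ criticalPoints F ↔ (wronskian Q P).eval z = 0 := by
  rw [criticalPoints, Set.mem_ofPred_eq, h.isPoleOf_iff]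
  by_cases hz : Q.eval z = 0
  · have hPz : P.eval z ≠ 0 := fun hPz => by
      obtain ⟨a, b, hab⟩ := h.1
      have := congrArg (eval z) hab
      simp [hz, hPz] at this
    have hP : P ≠ 0 := fun hP => hPz (by simp [hP])
    simp only [hz, not_true_eq_false, false_and, true_and, false_or]
    rw [(h.inv hP).deriv_ratVal hPz, div_eq_zero_iff, or_iff_left (pow_ne_zero 2 hPz),
      ← wronskian_neg_eq, eval_neg, neg_eq_zero]
  · simp only [hz, not_false_eq_true, true_and, false_and, or_false]
    rw [h.deriv_ratVal hz, div_eq_zero_iff, or_iff_left (pow_ne_zero 2 hz)]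

/-- In terms of `z⁻¹`, the quotient becomes that of the reversed polynomials, whose constant terms
are the leading coefficients. -/
theorem tendsto_ratVal_div (h : IsReducedForm F P Q) {n : ℕ} (hP : P.natDegree = n + 1)
    (hQ : Q.natDegree = n) :
    Tendsto (fun z : ℂ => ratVal F z / z) (Bornology.cobounded ℂ)
      (𝓝 (P.leadingCoeff / Q.leadingCoeff)) := by
  have hrev : ∀ (R : ℂ[X]) {z : ℂ}, z ≠ 0 → R.eval z = R.reverse.eval z⁻¹ * z ^ R.natDegree := by
    intro R z hz
    let := invertibleOfNonzero hz
    have := eval₂_reverse_mul_pow (RingHom.id ℂ) z R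
    rw [invOf_eq_inv, eval₂_id, eval₂_id] at this
    exact this.symm
  have hlim : ∀ R : ℂ[X], Tendsto (fun z : ℂ => R.reverse.eval z⁻¹) (Bornology.cobounded ℂ)
      (𝓝 R.leadingCoeff) := by
    intro R
    have h1 := (R.reverse.continuous.tendsto 0).comp (tendsto_inv₀_cobounded (α := ℂ))
    rwa [← coeff_zero_eq_eval_zero, coeff_zero_reverse] at h1
  refine ((hlim P).div (hlim Q) (leadingCoeff_ne_zero.2 h.2.1)).congr' ?_
  filter_upwards [Bornology.eventually_ne_cobounded (0 : ℂ)] with z hz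
  rw [h.ratVal_eq, hrev P hz, hrev Q hz, hP, hQ, Pi.div_apply]
  field_simp
  ring

end IsReducedForm

/-! ### From Wronskians back to rational functions -/

/-- A common factor `X - C a` of `p` and `q` comes out of the Wronskian squared, because the terms
with its derivative cancel. -/
theorem Polynomial.isCoprime_of_squarefree_wronskian {k : Type*} [Field k] [IsAlgClosed k]
    {p q : k[X]} (h : Squarefree (wronskian q p)) : IsCoprime p q := by
  classical
  rw [← EuclideanDomain.gcd_isUnit_iff]
  by_contra hg
  obtain ⟨a, ha⟩ : ∃ a, (EuclideanDomain.gcd p q).IsRoot a := by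
    refine IsAlgClosed.exists_root _ fun hd => hg ?_
    exact Polynomial.isUnit_iff_degree_eq_zero.2 hd
  rw [← dvd_iff_isRoot] at ha
  obtain ⟨u, hu⟩ := ha.trans (EuclideanDomain.gcd_dvd_left p q)
  obtain ⟨v, hv⟩ := ha.trans (EuclideanDomain.gcd_dvd_right p q)
  refine not_isUnit_X_sub_C a (h _ ⟨wronskian v u, ?_⟩)
  rw [hu, hv]
  simp only [wronskian, derivative_mul]
  ring

theorem Polynomial.Monic.eq_prod_X_sub_C_of_injective {k ι : Type*} [Field k]
    [Fintype ι] {p : k[X]} (hp : p.Monic) (hpn : p.natDegree = Fintype.card ι) {η : ι → k}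
    (hη : Function.Injective η) (hroot : ∀ i, p.eval (η i) = 0) :
    p = ∏ i, (X - C (η i)) := by
  have hdvd : ∏ i, (X - C (η i)) ∣ p := by
    refine Finset.prod_dvd_of_coprime (fun i _ j _ hij => ?_) fun i _ => dvd_iff_isRoot.2 (hroot i)
    exact isCoprime_X_sub_C_of_isUnit_sub (sub_ne_zero.2 (hη.ne hij)).isUnit
  refine eq_of_monic_of_dvd_of_natDegree_le (monic_prod_X_sub_C _ _) hp hdvd ?_
  simp [hpn]

/-- The normalized rational functions of type `(n + 1, n)` are quotients of polynomials in normal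
form. -/
theorem exists_isReducedForm_gapMonic {n : ℕ} {F : RatFunc ℂ} (hF : IsOfType F (n + 1) n)
    (hN : IsNormalized n F) : ∃ v : Fin n ⊕ Fin n → ℂ,
      IsReducedForm F (gapMonic (n + 1) (v ∘ Sum.inl)) (gapMonic n (v ∘ Sum.inr)) := by
  obtain ⟨P, Q, h, hP, hQ⟩ := hF
  obtain ⟨⟨P₁, Q₁, h₁, hP₁⟩, hlim⟩ := hN
  have hPn : P.natDegree = n + 1 := natDegree_eq_of_degree_eq_some (by exact_mod_cast hP)
  have hQn : Q.natDegree = n := natDegree_eq_of_degree_eq_some hQ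
  -- The two reduced forms of `F` may differ, but their numerators are nonzero multiples of `F.num`.
  have hPcoeff : P.coeff n = 0 := by
    obtain ⟨c, hc, hPc, -⟩ := h.exists_eq_C_mul
    obtain ⟨d, hd, hPd, -⟩ := h₁.exists_eq_C_mul
    rw [hPd, coeff_C_mul] at hP₁
    rw [hPc, coeff_C_mul, (mul_eq_zero.1 hP₁).resolve_left hd, mul_zero]
  have hlead : P.leadingCoeff = Q.leadingCoeff :=
    eq_of_div_eq_one (tendsto_nhds_unique (h.tendsto_ratVal_div hPn hQn) hlim)
  have hQ0 : Q.leadingCoeff ≠ 0 := leadingCoeff_ne_zero.2 h.2.1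
  have hc : Q.leadingCoeff⁻¹ ≠ 0 := inv_ne_zero hQ0
  have hPm : (C Q.leadingCoeff⁻¹ * P).Monic :=
    monic_C_mul_of_mul_leadingCoeff_eq_one (by rw [hlead, inv_mul_cancel₀ hQ0])
  have hQm : (C Q.leadingCoeff⁻¹ * Q).Monic :=
    monic_C_mul_of_mul_leadingCoeff_eq_one (inv_mul_cancel₀ hQ0)
  have eP := eq_gapMonic (n := n) hPm ((natDegree_C_mul hc).trans hPn) n.le_succ fun j h1 h2 => by
    obtain rfl : j = n := by omega
    rw [coeff_C_mul, hPcoeff, mul_zero]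
  have eQ := eq_gapMonic (n := n) hQm ((natDegree_C_mul hc).trans hQn) le_rfl
    fun j h1 h2 => by omega
  refine ⟨Sum.elim (fun i => (C Q.leadingCoeff⁻¹ * P).coeff i)
    fun i => (C Q.leadingCoeff⁻¹ * Q).coeff i, ?_⟩
  rw [Sum.elim_comp_inl, Sum.elim_comp_inr, ← eP, ← eQ]
  exact h.C_mul hc

theorem isOfType_and_isNormalized_of_gapMonic {n : ℕ} {F : RatFunc ℂ} {v : Fin n ⊕ Fin n → ℂ}
    (h : IsReducedForm F (gapMonic (n + 1) (v ∘ Sum.inl)) (gapMonic n (v ∘ Sum.inr))) :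
    IsOfType F (n + 1) n ∧ IsNormalized n F := by
  refine ⟨⟨_, _, h, ?_, degree_gapMonic le_rfl _⟩, ⟨_, _, h, by simp [coeff_gapMonic]⟩, ?_⟩
  · exact_mod_cast degree_gapMonic n.le_succ _
  · have := h.tendsto_ratVal_div (natDegree_gapMonic n.le_succ _) (natDegree_gapMonic le_rfl _)
    rwa [monic_gapMonic n.le_succ, monic_gapMonic le_rfl, div_one] at this

theorem mainTheorem2 (n : ℕ) (η : Fin (2 * n) → ℂ) (hη : Function.Injective η) :
    (∃ F : RatFunc ℂ, IsOfType F (n + 1) n ∧ IsNormalized n F ∧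
      criticalPoints F = Set.range η) ∧
    {F : RatFunc ℂ | IsOfType F (n + 1) n ∧ IsNormalized n F ∧
      criticalPoints F = Set.range η}.Finite := by
  have hTm : (∏ i, (X - C (η i))).Monic := monic_prod_X_sub_C _ _
  have hTn : (∏ i, (X - C (η i))).natDegree = 2 * n := by
    simp
  obtain ⟨⟨v, hv⟩, hfin⟩ := exists_wronskian_gapMonic_and_finite hTm hTn
  constructor
  · have hsep : (∏ i, (X - C (η i))).Separable := separable_prod_X_sub_C_iff.2 hη
    have hco := isCoprime_of_squarefree_wronskian (hv ▸ hsep.squarefree)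
    have h : IsReducedForm _ (gapMonic (n + 1) (v ∘ Sum.inl)) (gapMonic n (v ∘ Sum.inr)) :=
      ⟨hco, (monic_gapMonic le_rfl _).ne_zero, rfl⟩
    obtain ⟨h1, h2⟩ := isOfType_and_isNormalized_of_gapMonic h
    refine ⟨_, h1, h2, ?_⟩
    ext z
    rw [h.mem_criticalPoints_iff, hv, eval_prod, Finset.prod_eq_zero_iff]
    simp [sub_eq_zero, eq_comm]
  · refine (hfin.image fun v => algebraMap ℂ[X] (RatFunc ℂ) (gapMonic (n + 1) (v ∘ Sum.inl)) /
      algebraMap ℂ[X] (RatFunc ℂ) (gapMonic n (v ∘ Sum.inr))).subset ?_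
    rintro F ⟨hF, hN, hcrit⟩
    obtain ⟨v, h⟩ := exists_isReducedForm_gapMonic hF hN
    refine ⟨v, ?_, h.2.2.symm⟩
    obtain ⟨hd, hlead⟩ := monic_wronskian (monic_gapMonic n.le_succ (v ∘ Sum.inl))
      (natDegree_gapMonic n.le_succ _) (monic_gapMonic le_rfl (v ∘ Sum.inr))
      (natDegree_gapMonic le_rfl _)
    -- The Wronskian is monic of degree `2n` and vanishes at the `2n` distinct points `η i`, so the
    -- critical set alone determines it.
    have hm := monic_of_natDegree_le_of_coeff_eq_one _ hd hlead
    refine hm.eq_prod_X_sub_C_of_injective ?_ hη fun i => ?_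
    · rw [Fintype.card_fin]
      exact hd.antisymm (le_natDegree_of_ne_zero (by rw [hlead]; exact one_ne_zero))
    · rw [← h.mem_criticalPoints_iff, hcrit]
      exact ⟨i, rfl⟩
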